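/- Let $X=[0,1)$ with addition modulo $1$ (that is, the circle group $\mathbb R/\mathbb Z$) and Lebesgue measure $\mu$. Let $\mathbb D=\bigcup_{n\ge 0}\{i/2^n : 0\le i\le 2^n-1\}\subseteq X$ be the group of dyadic rationals modulo $1$, let $\Delta_r=\{(x,x+r):x\in X\}$ for $r\in\mathbb D$, and let $R=\bigcup_{r\in\mathbb D}\Delta_r\subseteq X\times X$, equipped with the right counting measure $\nu(E)=\int_X |\{z\in X:(z,y)\in E\}|\,d\mu(y)$. For $D\subseteq\mathbb D$ let $\Delta(D)=\bigcup_{r\in D}\Delta_r$. For $\alpha\in L^\infty(X,\mu)$ let $D(\alpha)$ be the operator on $L^2(R,\nu)$ given by $(D(\alpha)\xi)(x,y)=\alpha(x)\xi(x,y)$, and let $\mathcal A=\{D(\alpha):\alpha\in L^\infty(X,\mu)\}$. An element $u$ of the extended Haagerup tensor product $\mathcal A\otimes_{\mathrm{eh}}\mathcal A$ is given by a series $u=\sum_{i=1}^\infty A_i\otimes B_i$ with $A_i=D(a_i)$ and $B_i=D(b_i)$ in $\mathcal A$ such that, for some constant $C$, $\|\sum_i A_iA_i^*\|\le C$ and $\|\sum_i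 B_i^*B_i\|\le C$ (weak* convergent sums). Let $\phi_u\in L^\infty(R,\nu)$ be given by $\phi_u(x,y)=\sum_{i=1}^\infty a_i(x)b_i(y)$ for $\nu$-almost every $(x,y)\in R$, and let $\mathfrak A(R)=\{\phi_u : u\in\mathcal A\otimes_{\mathrm{eh}}\mathcal A\}\subseteq L^\infty(R,\nu)$. Then: 1. If $\emptyset\ne D\subsetneq\mathbb D$ and either $D$ or $\mathbb D\setminus D$ is dense in $[0,1)$, then the characteristic function $\chi_{\Delta(D)}$ is not in $\mathfrak A(R)$. 2. Let $0\ne\phi\in L^\infty(R,\nu)$ and let $E$ be the set of all $r\in\mathbb D$ such that $\phi(x,x+r)=0$ for $\mu$-almost every $x\in X$. If $E$ is dense in $[0,1)$, then $\phi\notin\mathfrak A(R)$. -/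

import Mathlib

open MeasureTheory Set Filter
open scoped ENNReal

noncomputable section

namespace DyadicSchur

/-- `X` is the interval `[0,1)` with addition modulo `1`, that is, the circle group `ℝ/ℤ`; its
Lebesgue probability measure `μ` is `volume`, and `((t : ℝ) : X)` is the class of `t` mod `1`. -/
abbrev X : Type := UnitAddCircle

/-- Lebesgue measure on `X`. -/
abbrev μ : Measure X := volume

/-- `𝔻ₙ = {i / 2ⁿ : 0 ≤ i ≤ 2ⁿ - 1}` as a subset of `X`. -/
def dyadicLevel (n : ℕ) : Set X :=
  {x | ∃ i : ℕ, i < 2 ^ n ∧ x = (((i : ℝ) / 2 ^ n : ℝ) : X)}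

/-- `𝔻 = ⋃ₙ 𝔻ₙ`. -/
def dyadic : Set X := ⋃ n, dyadicLevel n

theorem dyadic_countable : dyadic.Countable := by
  refine countable_iUnion fun n => ?_
  refine (countable_range fun i : ℕ => (((i : ℝ) / 2 ^ n : ℝ) : X)).mono ?_
  rintro x ⟨i, -, rfl⟩
  exact ⟨i, rfl⟩

instance : Countable dyadic := dyadic_countable.to_subtype

/-- The orbit equivalence relation `R = {(x, x + r) : x ∈ X, r ∈ 𝔻}` of the translation action. -/
def R : Set (X × X) := {p | ∃ r ∈ dyadic, p.2 = p.1 + r}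

/-- The point `(x, x + r)` of the diagonal `Δ_r`. -/
def diagPt (r : dyadic) (x : X) : R := ⟨(x, x + r), r, r.2, rfl⟩

/-- The set `Δ(D) = ⋃_{r ∈ D} Δ_r`, where `Δ_r = {(x, x + r) : x ∈ X}`, for `D ⊆ 𝔻`. -/
def Delta (D : Set dyadic) : Set R := ⋃ r ∈ D, range (diagPt r)

/-- The number (possibly infinite) of points in the horizontal slice
`E_y = {(z, y) : (z, y) ∈ E}`. -/
def sliceCard (E : Set R) (y : X) : ℝ≥0∞ := ({p ∈ E | p.1.2 = y}.encard : ℝ≥0∞)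

theorem measurable_diagPt_sub (r : dyadic) : Measurable fun y : X => diagPt r (y - r) := by
  refine Measurable.subtype_mk ?_
  fun_prop

theorem sliceCard_eq_tsum (E : Set R) (y : X) :
    sliceCard E y = ∑' r : dyadic, E.indicator (fun _ => (1 : ℝ≥0∞)) (diagPt r (y - r)) := by
  set S : Set dyadic := {r | diagPt r (y - r) ∈ E} with hS
  have himg : {p ∈ E | p.1.2 = y} = (fun r : dyadic => diagPt r (y - r)) '' S := by
    ext p
    constructor
    · rintro ⟨hp, hy⟩
      obtain ⟨⟨x, z⟩, r, hr, hz⟩ := p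
      simp only at hy hz
      subst hy
      have : diagPt ⟨r, hr⟩ (z - r) = ⟨(x, z), r, hr, hz⟩ := by
        apply Subtype.ext
        simp [diagPt, hz]
      exact ⟨⟨r, hr⟩, by simpa [hS, this] using hp, this⟩
    · rintro ⟨r, hr, rfl⟩
      exact ⟨hr, by simp [diagPt]⟩
  have hinj : Function.Injective fun r : dyadic => diagPt r (y - r) := by
    intro r s h
    have := congrArg (fun p : R => p.1.1) h
    simp only [diagPt, sub_right_inj] at this
    exact Subtype.ext this
  rw [sliceCard, himg, hinj.encard_image, ← ENNReal.tsum_set_one,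
    tsum_subtype S fun _ => (1 : ℝ≥0∞)]
  rfl

theorem measurable_sliceCard {E : Set R} (hE : MeasurableSet E) : Measurable (sliceCard E) := by
  have : sliceCard E = fun y =>
      ∑' r : dyadic, E.indicator (fun _ => (1 : ℝ≥0∞)) (diagPt r (y - r)) :=
    funext (sliceCard_eq_tsum E)
  rw [this]
  exact Measurable.tsum fun r =>
    (measurable_const.indicator hE).comp (measurable_diagPt_sub r)

/-- The right counting measure `ν(E) = ∫_X |E_y| dμ(y)` of `R`. -/
def ν : Measure R :=
  Measure.ofMeasurable (fun E _ => ∫⁻ y, sliceCard E y ∂μ)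
    (by simp [sliceCard])
    (by
      intro f hf hd
      rw [← lintegral_tsum fun i => (measurable_sliceCard (hf i)).aemeasurable]
      refine lintegral_congr fun y => ?_
      simp_rw [sliceCard_eq_tsum]
      rw [ENNReal.tsum_comm]
      refine tsum_congr fun r => ?_
      by_cases h : ∃ i, diagPt r (y - r) ∈ f i
      · obtain ⟨i, hi⟩ := h
        rw [tsum_eq_single i fun j hj => indicator_of_notMem
            (fun hj' => (hd hj).le_bot ⟨hj', hi⟩) _,
          indicator_of_mem hi, indicator_of_mem (mem_iUnion.2 ⟨i, hi⟩)]
      · simp only [not_exists] at h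
        rw [indicator_of_notMem (by simpa using h)]
        simp [h])

theorem ν_apply {E : Set R} (hE : MeasurableSet E) : ν E = ∫⁻ y, sliceCard E y ∂μ :=
  Measure.ofMeasurable_apply E hE

theorem quasiMeasurePreserving_fst :
    Measure.QuasiMeasurePreserving (fun p : R => p.1.1) ν μ := by
  have hm : Measurable fun p : R => p.1.1 := measurable_fst.comp measurable_subtype_coe
  refine ⟨hm, Measure.AbsolutelyContinuous.mk fun N hN h0 => ?_⟩
  rw [Measure.map_apply hm hN, ν_apply (hm hN)]
  simp_rw [sliceCard_eq_tsum]
  have hmeas (r : dyadic) : Measurable fun y : X =>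
      ((fun p : R => p.1.1) ⁻¹' N).indicator (fun _ => (1 : ℝ≥0∞)) (diagPt r (y - r)) :=
    (measurable_const.indicator (hm hN)).comp (measurable_diagPt_sub r)
  rw [lintegral_tsum fun r => (hmeas r).aemeasurable]
  refine ENNReal.tsum_eq_zero.2 fun r => ?_
  have : (fun y : X => ((fun p : R => p.1.1) ⁻¹' N).indicator (fun _ => (1 : ℝ≥0∞))
      (diagPt r (y - r))) = ((fun y : X => y - r) ⁻¹' N).indicator 1 := by
    ext y
    rfl
  rw [this, lintegral_indicator_one (measurable_sub_const _ hN)]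
  exact (measurePreserving_sub_right μ (r : X)).quasiMeasurePreserving.preimage_null h0

theorem measurableSet_Delta (D : Set dyadic) : MeasurableSet (Delta D) := by
  refine MeasurableSet.biUnion (to_countable D) fun r _ => ?_
  have : range (diagPt r) = {p : R | p.1.2 = p.1.1 + r} := by
    ext ⟨⟨x, z⟩, h⟩
    constructor
    · rintro ⟨x', hx⟩
      rw [← hx]
      rfl
    · intro hp
      exact ⟨x, Subtype.ext (Prod.ext rfl hp.symm)⟩
  rw [this]
  exact measurableSet_eq_fun (by fun_prop) (by fun_prop)

theorem memLp_indicator_Delta (D : Set dyadic) :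
    MemLp ((Delta D).indicator fun _ => (1 : ℂ)) ∞ ν :=
  (memLp_top_const (1 : ℂ)).indicator (measurableSet_Delta D)

/-- The characteristic function `χ_{Δ(D)}` as an element of `L^∞(R, ν)`. -/
def chiDelta (D : Set dyadic) : Lp ℂ ∞ ν := (memLp_indicator_Delta D).toLp _

/-- The Hilbert space `H = L²(R, ν)`. -/
abbrev H : Type := Lp ℂ 2 ν

theorem memLp_comp_fst (α : Lp ℂ ∞ μ) : MemLp (fun p : R => α p.1.1) ∞ ν := by
  refine memLp_top_of_bound
    ((Lp.aestronglyMeasurable α).comp_quasiMeasurePreserving quasiMeasurePreserving_fst) ‖α‖ ?_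
  refine quasiMeasurePreserving_fst.ae (p := fun x => ‖α x‖ ≤ ‖α‖) ?_
  filter_upwards [ae_le_eLpNormEssSup (f := α) (μ := μ)] with x hx
  rw [Lp.norm_def, eLpNorm_exponent_top, ← toReal_enorm]
  refine ENNReal.toReal_mono ?_ hx
  rw [← eLpNorm_exponent_top]
  exact Lp.eLpNorm_ne_top α

/-- For `α ∈ L^∞(X, μ)`, the function `c(α)(x, y) = α(x)` in `L^∞(R, ν)`. -/
def colFun (α : Lp ℂ ∞ μ) : Lp ℂ ∞ ν := (memLp_comp_fst α).toLp _

/-- The operator `D(α)` on `H`, for `α ∈ L^∞(X, μ)`. It is convolution by the function `d(α)` that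
equals `α(x)` at `(x, x)` and vanishes off the diagonal. The convolution sum
`∑_{z ∼ x} d(α)(x, z) ξ(z, y)` has the single term `z = x`, so
`(D(α) ξ)(x, y) = α(x) ξ(x, y)`. -/
def diagOp (α : Lp ℂ ∞ μ) : H →L[ℂ] H :=
  (ContinuousLinearMap.mul ℂ ℂ).holderL ν ∞ 2 2 (colFun α)

theorem diagOp_apply (α : Lp ℂ ∞ μ) (ξ : H) :
    diagOp α ξ =ᵐ[ν] fun p => α p.1.1 * ξ p := by
  filter_upwards [(ContinuousLinearMap.mul ℂ ℂ).coeFn_holder (r := 2) (colFun α) ξ,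
    (memLp_comp_fst α).coeFn_toLp] with p h1 h2
  simp only [diagOp, ContinuousLinearMap.holderL_apply_apply]
  rw [h1, ContinuousLinearMap.mul_apply', colFun, h2]

/-- The Cartan masa `𝒜 = {D(α) : α ∈ L^∞(X, μ)}`, a set of operators on `H`. -/
def cartanMasa : Set (H →L[ℂ] H) := range diagOp

/-- The sequences `A, B` in `𝒜` define an element `u = ∑ᵢ Aᵢ ⊗ Bᵢ` of the extended Haagerup tensor
product `𝒜 ⊗_eh 𝒜`: for some constant `C`, `‖∑ᵢ Aᵢ Aᵢ*‖ ≤ C` and `‖∑ᵢ Bᵢ* Bᵢ‖ ≤ C`. The terms being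
positive, such a series converges weak* to an operator of norm at most `C` if and only if all its
partial sums have norm at most `C`. -/
def IsHaagerupSeries (A B : ℕ → H →L[ℂ] H) : Prop :=
  (∀ i, A i ∈ cartanMasa) ∧ (∀ i, B i ∈ cartanMasa) ∧
    ∃ C : ℝ, ∀ n : ℕ,
      ‖∑ i ∈ Finset.range n, A i ∘L (A i).adjoint‖ ≤ C ∧
      ‖∑ i ∈ Finset.range n, (B i).adjoint ∘L B i‖ ≤ C

/-- The function `f_u(x, y) = ∑ᵢ aᵢ(x) bᵢ(y)` on `X × X`. If `∑ᵢ D(aᵢ) ⊗ D(bᵢ)` is an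
element of `𝒜 ⊗_eh 𝒜`, then the series converges absolutely, and is independent of the
representatives of `aᵢ` and `bᵢ`, off a marginally null set. -/
def seriesFun (a b : ℕ → Lp ℂ ∞ μ) (p : X × X) : ℂ := ∑' i, a i p.1 * b i p.2

/-- `𝔄(R) = {φ_u : u ∈ 𝒜 ⊗_eh 𝒜} ⊆ L^∞(R, ν)`, where `φ_u` is the restriction to `R` of the function
`f_u` attached to `u = ∑ᵢ Aᵢ ⊗ Bᵢ`, with `Aᵢ = D(aᵢ)` and `Bᵢ = D(bᵢ)`. -/
def frakA : Set (Lp ℂ ∞ ν) :=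
  {φ | ∃ a b : ℕ → Lp ℂ ∞ μ,
    IsHaagerupSeries (fun i => diagOp (a i)) (fun i => diagOp (b i)) ∧
      φ =ᵐ[ν] fun p : R => seriesFun a b p}

/-- The set `{r ∈ 𝔻 : φ|_{Δ_r} = 0 μ-a.e.}`, for `φ ∈ L^∞(R, ν)`. -/
def vanishingSet (φ : Lp ℂ ∞ ν) : Set dyadic := {r | ∀ᵐ x ∂μ, φ (diagPt r x) = 0}

end DyadicSchur

end

noncomputable section

namespace DyadicSchur

/-! The point is that `φ_u` is the restriction to `R` of a function on `X × X` that varies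
continuously, in a weak sense, from one diagonal to the next. For measurable `s`, the function `t ↦
∫ x in s, f_u(x, x + t)` is continuous on the whole circle: each term of the series gives a
correlation of two square-integrable functions, and the Haagerup bounds make the sum converge
uniformly in `t` (`IsHaagerupSeries.summable`, `continuous_setIntegral_seriesFun`). If `φ_u` equals
a constant `c` on a dense set of diagonals, this function is therefore `c μ(s)` for every `t`;
varying `s` gives `φ_u = c` a.e. on every diagonal (`ae_eq_const_of_dense`). Both claims follow,
with `c = 0` or `c = 1`. -/

/-! ### The measure `ν` as a sum over diagonals -/

theorem measurable_diagPt (r : dyadic) : Measurable (diagPt r) :=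
  Measurable.subtype_mk (by fun_prop)

/-- Translation invariance of `μ` lets each diagonal be parametrized by its first coordinate instead
of its second. Statements `ν`-a.e. then reduce to statements `μ`-a.e. on each diagonal. -/
theorem ν_eq_sum : ν = Measure.sum fun r : dyadic => μ.map (diagPt r) := by
  ext E hE
  rw [ν_apply hE, Measure.sum_apply _ hE]
  simp_rw [sliceCard_eq_tsum]
  have hmeas (r : dyadic) : Measurable fun y : X =>
      E.indicator (fun _ => (1 : ℝ≥0∞)) (diagPt r (y - r)) :=
    (measurable_const.indicator hE).comp (measurable_diagPt_sub r)
  rw [lintegral_tsum fun r => (hmeas r).aemeasurable]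
  refine tsum_congr fun r => ?_
  rw [Measure.map_apply (measurable_diagPt r) hE,
    ← lintegral_indicator_one (measurable_diagPt r hE)]
  exact lintegral_sub_right_eq_self (μ := μ)
    (fun x => (diagPt r ⁻¹' E).indicator (1 : X → ℝ≥0∞) x) (r : X)

theorem quasiMeasurePreserving_diagPt (r : dyadic) :
    Measure.QuasiMeasurePreserving (diagPt r) μ ν := by
  refine ⟨measurable_diagPt r, ?_⟩
  rw [ν_eq_sum]
  exact Measure.absolutelyContinuous_sum_right r Measure.AbsolutelyContinuous.rfl

theorem ae_ν_iff {P : R → Prop} (hP : MeasurableSet {p | P p}) :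
    (∀ᵐ p ∂ν, P p) ↔ ∀ r : dyadic, ∀ᵐ x ∂μ, P (diagPt r x) := by
  rw [ν_eq_sum, Measure.ae_sum_iff]
  exact forall_congr' fun r => ae_map_iff (measurable_diagPt r).aemeasurable hP

theorem zero_mem_dyadic : (0 : X) ∈ dyadic :=
  mem_iUnion.2 ⟨0, 0, by simp, by simp⟩

theorem diagPt_mem_Delta {D : Set dyadic} {r : dyadic} {x : X} :
    diagPt r x ∈ Delta D ↔ r ∈ D := by
  simp only [Delta, mem_iUnion, mem_range, exists_prop]
  constructor
  · rintro ⟨s, hs, y, hy⟩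
    have h1 : y = x := congrArg (fun p : R => p.1.1) hy
    have h2 : y + (s : X) = x + r := congrArg (fun p : R => p.1.2) hy
    rw [h1, add_right_inj] at h2
    rwa [← Subtype.ext h2]
  · exact fun h => ⟨r, h, x, rfl⟩

theorem ν_Delta_singleton (r : dyadic) : ν (Delta {r}) = 1 := by
  rw [ν_eq_sum, Measure.sum_apply _ (measurableSet_Delta _), tsum_eq_single r]
  · rw [Measure.map_apply (measurable_diagPt r) (measurableSet_Delta _)]
    have : diagPt r ⁻¹' Delta {r} = univ := by
      ext x
      simp [diagPt_mem_Delta]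
    rw [this, UnitAddCircle.measure_univ]
  · intro s hs
    rw [Measure.map_apply (measurable_diagPt s) (measurableSet_Delta _)]
    have : diagPt s ⁻¹' Delta {r} = ∅ := by
      ext x
      simp [diagPt_mem_Delta, hs]
    rw [this, measure_empty]

/-! ### Square-summability from the operator bounds -/

/-- The indicator function of the main diagonal, a unit vector of `H`. -/
def diagVec : H :=
  indicatorConstLp 2 (measurableSet_Delta {⟨0, zero_mem_dyadic⟩})
    (by rw [ν_Delta_singleton]; exact ENNReal.one_ne_top) (1 : ℂ)

theorem norm_diagVec : ‖diagVec‖ = 1 := by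
  rw [diagVec, norm_indicatorConstLp (by norm_num) (by norm_num), measureReal_def,
    ν_Delta_singleton]
  simp

theorem diagVec_diagPt :
    ∀ᵐ x ∂μ, diagVec (diagPt ⟨0, zero_mem_dyadic⟩ x) = 1 := by
  filter_upwards [(quasiMeasurePreserving_diagPt ⟨0, zero_mem_dyadic⟩).ae
    (indicatorConstLp_coeFn (p := 2) (c := (1 : ℂ))
      (hs := measurableSet_Delta {⟨0, zero_mem_dyadic⟩})
      (hμs := by rw [ν_Delta_singleton]; exact ENNReal.one_ne_top))] with x hx
  rw [diagVec, hx, indicator_of_mem (diagPt_mem_Delta.2 (mem_singleton _))]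

theorem memLp_of_linf (p : ℝ≥0∞) (α : Lp ℂ ∞ μ) : MemLp α p μ :=
  (Lp.memLp α).mono_exponent le_top

theorem integrable_norm_sq (α : Lp ℂ ∞ μ) : Integrable (fun x => ‖α x‖ ^ 2) μ :=
  (memLp_of_linf 2 α).integrable_norm_pow (by norm_num)

/-- On the main diagonal `diagOp α diagVec` is a copy of `α`, and that diagonal carries one summand
of `ν`. -/
theorem integral_norm_sq_le (α : Lp ℂ ∞ μ) :
    ∫ x, ‖α x‖ ^ 2 ∂μ ≤ ‖diagOp α diagVec‖ ^ 2 := by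
  have hint : Integrable (fun p => ‖diagOp α diagVec p‖ ^ 2) ν :=
    (Lp.memLp (diagOp α diagVec)).integrable_norm_pow (by norm_num)
  have hsq : ‖diagOp α diagVec‖ ^ 2 = ∫ p, ‖diagOp α diagVec p‖ ^ 2 ∂ν := by
    rw [← inner_self_eq_norm_sq (𝕜 := ℂ), L2.inner_def, ← integral_re (L2.integrable_inner _ _)]
    simp [inner_self_eq_norm_sq_to_K, ← Complex.ofReal_pow]
  rw [hsq]
  have hle : μ.map (diagPt ⟨0, zero_mem_dyadic⟩) ≤ ν := by
    rw [ν_eq_sum]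
    exact Measure.le_sum (fun r : dyadic => μ.map (diagPt r)) ⟨0, zero_mem_dyadic⟩
  refine le_trans (le_of_eq ?_) (integral_mono_measure hle (ae_of_all _ fun p => by positivity) hint)
  rw [integral_map (measurable_diagPt _).aemeasurable (hint.mono_measure hle).aestronglyMeasurable]
  refine integral_congr_ae ?_
  filter_upwards [diagVec_diagPt,
    (quasiMeasurePreserving_diagPt ⟨0, zero_mem_dyadic⟩).ae (diagOp_apply α diagVec)] with x h1 h2
  rw [h2, h1, mul_one]
  rfl

theorem adjoint_diagOp (α : Lp ℂ ∞ μ) : (diagOp α).adjoint = diagOp (star α) := by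
  symm
  rw [ContinuousLinearMap.eq_adjoint_iff]
  intro ξ η
  rw [L2.inner_def, L2.inner_def]
  refine integral_congr_ae ?_
  filter_upwards [diagOp_apply (star α) ξ, diagOp_apply α η,
    quasiMeasurePreserving_fst.ae (Lp.coeFn_star α)] with p h1 h2 h3
  rw [h1, h2, h3]
  simp [mul_comm, mul_assoc]

theorem norm_adjoint_diagOp (α : Lp ℂ ∞ μ) (ξ : H) :
    ‖(diagOp α).adjoint ξ‖ = ‖diagOp α ξ‖ := by
  rw [adjoint_diagOp]
  refine le_antisymm ?_ ?_ <;> refine Lp.norm_le_norm_of_ae_le ?_ <;>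
  · filter_upwards [diagOp_apply (star α) ξ, diagOp_apply α ξ,
      quasiMeasurePreserving_fst.ae (Lp.coeFn_star α)] with p h1 h2 h3
    rw [h1, h2, h3]
    simp

theorem sum_norm_sq_le {E : Type*} [NormedAddCommGroup E] [InnerProductSpace ℂ E]
    [CompleteSpace E] (T : ℕ → E →L[ℂ] E) (n : ℕ) (ξ : E) :
    ∑ i ∈ Finset.range n, ‖T i ξ‖ ^ 2 ≤
      ‖∑ i ∈ Finset.range n, (T i).adjoint ∘L T i‖ * ‖ξ‖ ^ 2 := by
  set S := ∑ i ∈ Finset.range n, (T i).adjoint ∘L T i with hS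
  have h : ∑ i ∈ Finset.range n, ‖T i ξ‖ ^ 2 = RCLike.re (inner ℂ (S ξ) ξ) := by
    rw [hS, sum_apply, sum_inner, map_sum]
    refine Finset.sum_congr rfl fun i _ => ?_
    rw [ContinuousLinearMap.comp_apply, ContinuousLinearMap.adjoint_inner_left,
      inner_self_eq_norm_sq]
  rw [h]
  calc RCLike.re (inner ℂ (S ξ) ξ) ≤ ‖S ξ‖ * ‖ξ‖ := re_inner_le_norm _ _
    _ ≤ ‖S‖ * ‖ξ‖ * ‖ξ‖ := by gcongr; exact S.le_opNorm ξ
    _ = ‖S‖ * ‖ξ‖ ^ 2 := by ring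

theorem summable_integral_norm_sq_of_le {a : ℕ → Lp ℂ ∞ μ} {C : ℝ}
    (h : ∀ n, ‖∑ i ∈ Finset.range n, (diagOp (a i)).adjoint ∘L diagOp (a i)‖ ≤ C) :
    Summable fun i => ∫ x, ‖a i x‖ ^ 2 ∂μ := by
  refine summable_of_sum_range_le (c := C) (fun i => integral_nonneg fun x => by positivity)
    fun n => ?_
  refine (Finset.sum_le_sum fun i _ => integral_norm_sq_le (a i)).trans ?_
  refine (sum_norm_sq_le (fun i => diagOp (a i)) n diagVec).trans ?_
  rw [norm_diagVec]
  simpa using h n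

theorem IsHaagerupSeries.summable {a b : ℕ → Lp ℂ ∞ μ}
    (h : IsHaagerupSeries (fun i => diagOp (a i)) (fun i => diagOp (b i))) :
    (Summable fun i => ∫ x, ‖a i x‖ ^ 2 ∂μ) ∧ Summable fun i => ∫ x, ‖b i x‖ ^ 2 ∂μ := by
  obtain ⟨-, -, C, hC⟩ := h
  refine ⟨?_, summable_integral_norm_sq_of_le fun n => (hC n).2⟩
  refine summable_of_sum_range_le (c := C) (fun i => integral_nonneg fun x => by positivity)
    fun n => ?_
  -- The bound for `a` concerns `A Aᵢ*` in the other order, so the estimate is applied to the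
  -- adjoints; by normality they have the same norm on each vector.
  refine (Finset.sum_le_sum fun i _ => (integral_norm_sq_le (a i)).trans_eq
    (congrArg (· ^ 2) (norm_adjoint_diagOp (a i) diagVec).symm)).trans ?_
  refine (sum_norm_sq_le (fun i => (diagOp (a i)).adjoint) n diagVec).trans ?_
  rw [norm_diagVec]
  simpa using (hC n).1


/-! ### Continuity in the translation parameter -/

/-- The integral is the `L²` inner product of a fixed vector with a translate of `β`, and
translation acts continuously on `L²`. -/
theorem continuous_setIntegral_mul_translate {s : Set X} (hs : MeasurableSet s)
    (α β : Lp ℂ ∞ μ) : Continuous fun t : X => ∫ x in s, α x * β (x + t) ∂μ := by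
  have : Fact ((2 : ℝ≥0∞) ≠ ∞) := ⟨by norm_num⟩
  set u : Lp ℂ 2 μ := (((memLp_of_linf 2 (star α)).indicator hs).toLp _) with hu
  set v : Lp ℂ 2 μ := (memLp_of_linf 2 β).toLp _ with hv
  have hc : Continuous fun t : X => inner ℂ u (DomAddAct.mk t +ᵥ v) := by
    have hmk : Continuous fun t : X => DomAddAct.mk t := DomAddAct.continuous_mk
    exact continuous_const.inner (hmk.vadd continuous_const)
  convert hc using 2 with t
  rw [L2.inner_def, ← integral_indicator hs]
  refine integral_congr_ae ?_
  have h3 : ∀ᵐ x ∂μ, v (x + t) = β (x + t) :=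
    (measurePreserving_add_right μ t).quasiMeasurePreserving.ae
      (p := fun x => v x = β x) (memLp_of_linf 2 β).coeFn_toLp
  filter_upwards [((memLp_of_linf 2 (star α)).indicator hs).coeFn_toLp, Lp.coeFn_star α,
    DomAddAct.vadd_Lp_ae_eq (DomAddAct.mk t) v, h3] with x h1 h2 h4 h5
  rw [hu, h1, h4, Equiv.symm_apply_apply, vadd_eq_add, add_comm t x, h5]
  by_cases hx : x ∈ s
  · simp [hx, h2, mul_comm]
  · simp [hx]

theorem integrable_norm_sq_translate (β : Lp ℂ ∞ μ) (t : X) :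
    Integrable (fun x => ‖β (x + t)‖ ^ 2) μ :=
  (integrable_norm_sq β).comp_add_right t

theorem norm_mul_le_half_sq_add_sq (z w : ℂ) : ‖z * w‖ ≤ (‖z‖ ^ 2 + ‖w‖ ^ 2) / 2 := by
  rw [norm_mul]
  nlinarith [sq_nonneg (‖z‖ - ‖w‖)]

theorem integrable_half_sq_add_sq (α β : Lp ℂ ∞ μ) (t : X) :
    Integrable (fun x => (‖α x‖ ^ 2 + ‖β (x + t)‖ ^ 2) / 2) μ := by
  have h : Integrable (fun x => ‖α x‖ ^ 2 + ‖β (x + t)‖ ^ 2) μ :=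
    (integrable_norm_sq α).add (integrable_norm_sq_translate β t)
  exact h.div_const 2

theorem integrable_mul_translate (α β : Lp ℂ ∞ μ) (t : X) :
    Integrable (fun x => α x * β (x + t)) μ := by
  refine (integrable_half_sq_add_sq α β t).mono' ?_
    (ae_of_all _ fun x => norm_mul_le_half_sq_add_sq _ _)
  exact (Lp.aestronglyMeasurable α).mul ((Lp.aestronglyMeasurable β).comp_quasiMeasurePreserving
    (measurePreserving_add_right μ t).quasiMeasurePreserving)

/-- The bound does not depend on `t`, so it serves both to interchange sum and integral and as the
majorant in the Weierstrass test. -/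
theorem setIntegral_norm_mul_translate_le (s : Set X) (α β : Lp ℂ ∞ μ) (t : X) :
    ∫ x in s, ‖α x * β (x + t)‖ ∂μ ≤
      (∫ x, ‖α x‖ ^ 2 ∂μ + ∫ x, ‖β x‖ ^ 2 ∂μ) / 2 := by
  calc ∫ x in s, ‖α x * β (x + t)‖ ∂μ ≤ ∫ x, ‖α x * β (x + t)‖ ∂μ :=
        setIntegral_le_integral (integrable_mul_translate α β t).norm
          (ae_of_all _ fun x => norm_nonneg _)
    _ ≤ ∫ x, (‖α x‖ ^ 2 + ‖β (x + t)‖ ^ 2) / 2 ∂μ :=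
        integral_mono (integrable_mul_translate α β t).norm (integrable_half_sq_add_sq α β t)
          fun x => norm_mul_le_half_sq_add_sq _ _
    _ = (∫ x, ‖α x‖ ^ 2 ∂μ + ∫ x, ‖β (x + t)‖ ^ 2 ∂μ) / 2 := by
        rw [integral_div]
        exact congrArg (· / 2)
          (integral_add (integrable_norm_sq α) (integrable_norm_sq_translate β t))
    _ = (∫ x, ‖α x‖ ^ 2 ∂μ + ∫ x, ‖β x‖ ^ 2 ∂μ) / 2 := by
        have h : ∫ x, ‖β (x + t)‖ ^ 2 ∂μ = ∫ x, ‖β x‖ ^ 2 ∂μ :=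
          integral_add_right_eq_self (fun x => ‖β x‖ ^ 2) t
        rw [h]

variable {a b : ℕ → Lp ℂ ∞ μ}

theorem continuous_setIntegral_seriesFun {s : Set X} (hs : MeasurableSet s)
    (ha : Summable fun i => ∫ x, ‖a i x‖ ^ 2 ∂μ) (hb : Summable fun i => ∫ x, ‖b i x‖ ^ 2 ∂μ) :
    Continuous fun t : X => ∫ x in s, seriesFun a b (x, x + t) ∂μ := by
  have hsum := (ha.add hb).div_const 2
  have heq (t : X) : ∫ x in s, seriesFun a b (x, x + t) ∂μ =
      ∑' i, ∫ x in s, a i x * b i (x + t) ∂μ :=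
    (hasSum_integral_of_summable_integral_norm
      (fun i => (integrable_mul_translate (a i) (b i) t).integrableOn)
      (hsum.of_nonneg_of_le (fun i => integral_nonneg fun x => norm_nonneg _)
        fun i => setIntegral_norm_mul_translate_le s (a i) (b i) t)).tsum_eq.symm
  simp_rw [heq]
  exact continuous_tsum (fun i => continuous_setIntegral_mul_translate hs (a i) (b i)) hsum
    fun i t => (norm_integral_le_integral_norm _).trans
      (setIntegral_norm_mul_translate_le s (a i) (b i) t)

/-! ### Rigidity on a dense set of diagonals -/

theorem integrable_comp_diagPt (φ : Lp ℂ ∞ ν) (r : dyadic) :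
    Integrable (fun x => φ (diagPt r x)) μ := by
  refine Integrable.of_bound ((Lp.aestronglyMeasurable φ).comp_quasiMeasurePreserving
    (quasiMeasurePreserving_diagPt r)) ‖φ‖ ?_
  refine (quasiMeasurePreserving_diagPt r).ae (p := fun p => ‖φ p‖ ≤ ‖φ‖) ?_
  filter_upwards [ae_le_eLpNormEssSup (f := φ) (μ := ν)] with x hx
  rw [Lp.norm_def, eLpNorm_exponent_top, ← toReal_enorm]
  refine ENNReal.toReal_mono ?_ hx
  rw [← eLpNorm_exponent_top]
  exact Lp.eLpNorm_ne_top φ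

/-- If an element of `𝔄(R)` is equal to the constant `c` on a dense set of diagonals, then it is
equal to `c` on all of them. -/
theorem ae_eq_const_of_dense {φ : Lp ℂ ∞ ν} (hφ : φ ∈ frakA) {c : ℂ} {S : Set dyadic}
    (hS : Dense (Subtype.val '' S)) (h : ∀ r ∈ S, ∀ᵐ x ∂μ, φ (diagPt r x) = c) (r : dyadic) :
    ∀ᵐ x ∂μ, φ (diagPt r x) = c := by
  obtain ⟨a, b, hab, heq⟩ := hφ
  obtain ⟨ha, hb⟩ := hab.summable
  have hser (r : dyadic) : ∀ᵐ x ∂μ, φ (diagPt r x) = seriesFun a b (x, x + r) :=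
    (quasiMeasurePreserving_diagPt r).ae (p := fun p => φ p = seriesFun a b p) heq
  refine Integrable.ae_eq_of_forall_setIntegral_eq (fun x => φ (diagPt r x)) (fun _ => c)
    (integrable_comp_diagPt φ r) (integrable_const c) fun s hs _ => ?_
  have hconst : (fun t : X => ∫ x in s, seriesFun a b (x, x + t) ∂μ) =
      fun _ => ∫ _ in s, c ∂μ := by
    refine Continuous.ext_on hS (continuous_setIntegral_seriesFun hs ha hb) continuous_const ?_
    rintro _ ⟨q, hq, rfl⟩
    refine integral_congr_ae (ae_restrict_of_ae ?_)
    filter_upwards [h q hq, hser q] with x h1 h2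
    rw [← h2, h1]
  rw [← congrFun hconst r]
  exact integral_congr_ae (ae_restrict_of_ae (hser r))

theorem eq_zero_of_forall_diagPt {φ : Lp ℂ ∞ ν}
    (h : ∀ r : dyadic, ∀ᵐ x ∂μ, φ (diagPt r x) = 0) : φ = 0 := by
  rw [Lp.eq_zero_iff_ae_eq_zero]
  exact (ae_ν_iff ((Lp.stronglyMeasurable φ).measurable (measurableSet_singleton 0))).2 h

theorem chiDelta_diagPt (D : Set dyadic) (r : dyadic) :
    ∀ᵐ x ∂μ, chiDelta D (diagPt r x) = D.indicator (fun _ => 1) r := by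
  filter_upwards [(quasiMeasurePreserving_diagPt r).ae (memLp_indicator_Delta D).coeFn_toLp]
    with x hx
  rw [chiDelta, hx]
  by_cases hr : r ∈ D
  · rw [indicator_of_mem (diagPt_mem_Delta.2 hr), indicator_of_mem hr]
  · rw [indicator_of_notMem (mt diagPt_mem_Delta.1 hr), indicator_of_notMem hr]

theorem indicator_eq_of_chiDelta_mem_frakA {D S : Set dyadic} (hD : chiDelta D ∈ frakA)
    (hS : Dense (Subtype.val '' S)) {c : ℂ} (h : ∀ r ∈ S, D.indicator (fun _ => 1) r = c)
    (r : dyadic) : D.indicator (fun _ => 1) r = c := by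
  have h1 := ae_eq_const_of_dense hD hS (c := c)
    (fun q hq => by rw [← h q hq]; exact chiDelta_diagPt D q) r
  -- Since `μ ≠ 0`, two a.e. statements share a point, which turns them into an equality of
  -- constants.
  obtain ⟨x, hx, hx'⟩ := (h1.and (chiDelta_diagPt D r)).exists
  rw [← hx, hx']

end DyadicSchur

end

open DyadicSchur in
theorem proposition6p8 :
    (∀ D : Set dyadic, D.Nonempty → D ≠ Set.univ →
      (Dense (Subtype.val '' D) ∨ Dense (Subtype.val '' Dᶜ)) →
        chiDelta D ∉ frakA) ∧
    (∀ φ : Lp ℂ ∞ ν, φ ≠ 0 → Dense (Subtype.val '' vanishingSet φ) → φ ∉ frakA) := by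
  refine ⟨?_, fun φ hne hd hφ =>
    hne (eq_zero_of_forall_diagPt (ae_eq_const_of_dense hφ hd fun r hr => hr))⟩
  rintro D ⟨q, hq⟩ hne (hd | hd) hD
  · obtain ⟨r, hr⟩ := (ne_univ_iff_exists_notMem D).1 hne
    have := indicator_eq_of_chiDelta_mem_frakA hD hd
      (fun s hs => indicator_of_mem hs fun _ => (1 : ℂ)) r
    rw [indicator_of_notMem hr] at this
    exact zero_ne_one this
  · have := indicator_eq_of_chiDelta_mem_frakA hD hd
      (fun s hs => indicator_of_notMem hs fun _ => (1 : ℂ)) q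
    rw [indicator_of_mem hq] at this
    exact one_ne_zero this
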